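/- **Setting.** There are $n+1$ processes with ids $\Pi=\{0,\dots,n\}$. Let $\mathcal I$ be a chromatic simplicial complex (the input complex): its vertices are pairs (process id, input value), and the vertices of a simplex have distinct ids. $Ch$ denotes the standard chromatic subdivision: a vertex of $Ch(\mathcal K)$ is a pair $(i,S)$ with $S$ a face of a simplex of $\mathcal K$ and $i\in ids(S)$; vertices $(i_0,S_0),\dots,(i_k,S_k)$ form a simplex iff the $S_j$ form a chain under inclusion and $i_a\in ids(S_b)$ implies $S_a\subseteq S_b$. The carrier of a vertex $v$ of $Ch^r(\mathcal I)$ is the smallest simplex $T$ of $\mathcal I$ such that $v$ is a vertex of $Ch^r(T)$. Let $U$ be a non-empty simplex of $\mathcal I$ and let $\delta_U$ be a partial protocol with respect to $U$, i.e. a decision map from process states to output values or $\perp$ (continue). Its protocol complexes are: $\mathbb F_0(U)$ is the set of simplices of $\mathcal I$ containing $U$; $\mathbb F_1(U)$ is the complex of all faces of configurations reached from simplices in $\mathbb F_0(U)$ by a one-round immediate-snapshot schedule (an ordered partition of the participating processes, each process reading the states of the processes in its own and in earlier blocks) whose first block is $ids(U)$; $\mathbb F_{i+1}(U)=\chi(\mathbb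 F_i(U),\delta_U)$ for $i\ge 1$, where the non-uniform chromatic subdivision $\chi$ keeps the terminated vertices of each simplex and joins them with the standard chromatic subdivision of the face spanned by its active vertices. Assume that in $\delta_U$ all processes terminate exactly at the end of round $r_m$. **Theorem.** Suppose $r_m\ge 2$. To every $n$-simplex $s^n$ of $Ch^{r_m}(\mathcal I)$ that has at least one vertex in $\mathbb F_{r_m}(U)$ one can assign a canonical neighbour $N(s^n,U)$ with label $U$, in such a way that: 1. $N(s^n,U)$ is an $n$-simplex of $\mathbb F_{r_m}(U)$, and if $s^n$ lies in $Ch^{r_m}(\sigma)$ for an $n$-simplex $\sigma$ of $\mathcal I$, then so does $N(s^n,U)$. 2. $N(s^n,U)$ contains every vertex of $s^n$ that is a vertex of $\mathbb F_{r_m}(U)$. 3. For every vertex $v$ of $s^n$ that is not a vertex of $\mathbb F_{r_m}(U)$, the vertex $v'$ of $N(s^n,U)$ with the same process id as $v$ has the same carrier in $\mathcal I$ as $v$. 4. If two such $n$-simplices $s^n_1,s^n_2$ (possibly in subdivisions of different input simplices) share a vertex with process id $p$, then $N(s^n_1,U)$ and $N(s^n_2,U)$ share a vertex with process id $p$. 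-/

import Mathlib

namespace NIIS

/-- Process states, stratified by the number of rounds. A state before the first round is a pair
(process id, input value). After one more round a process either has already terminated and keeps
its old state (`Sum.inl`), or it has a new state `(i, S)` (`Sum.inr`), where `i` is its id and `S`
is the simplex formed by the states it has read in that round. -/
def Vtx (n : ℕ) (X : Type*) : ℕ → Type _
  | 0 => Fin (n + 1) × X
  | k + 1 => Vtx n X k ⊕ (Fin (n + 1) × Finset (Vtx n X k))

variable {n : ℕ} {X Y : Type*}

/-- The process id (colour) of a state. -/
def pid : {k : ℕ} → Vtx n X k → Fin (n + 1)
  | 0, v => Prod.fst v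
  | _ + 1, Sum.inl v => pid v
  | _ + 1, Sum.inr w => w.1

/-- The set of process ids of a simplex. -/
def ids {k : ℕ} (s : Finset (Vtx n X k)) : Finset (Fin (n + 1)) := s.image pid

/-- The state `(i, S)` reached by process `i` when it reads the states in `S`. -/
def view {k : ℕ} (i : Fin (n + 1)) (S : Finset (Vtx n X k)) : Vtx n X (k + 1) := Sum.inr (i, S)

/-- The old state, kept by a process that has terminated. -/
def keep {k : ℕ} (v : Vtx n X k) : Vtx n X (k + 1) := Sum.inl v

/-- The vertices of a collection of simplices. -/
def vertices {V : Type*} (K : Set (Finset V)) : Set V := {v | ∃ t ∈ K, v ∈ t}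

/-- The input complex is chromatic: the vertices of a simplex have distinct process ids. -/
def IsChromatic (I : PreAbstractSimplicialComplex (Vtx n X 0)) : Prop :=
  ∀ s ∈ I.faces, Set.InjOn pid (s : Set (Vtx n X 0))

/-- The standard chromatic subdivision. The vertices are the pairs `(i, S)` with `S` a face of some
simplex of `K` and `i` a process id of `S` (so `S` is non-empty). Vertices `(i₀, S₀), …, (iₖ, Sₖ)`
form a simplex iff the `Sⱼ` form a chain and `i ∈ ids T` implies `S ⊆ T` for all vertices
`(i, S)`, `(j, T)` among them (in particular their ids are distinct). -/
def Ch {k : ℕ} (K : Set (Finset (Vtx n X k))) : Set (Finset (Vtx n X (k + 1))) :=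
  {t | t.Nonempty ∧
    (∀ v ∈ t, ∃ i S, v = view i S ∧ (∃ T ∈ K, S ⊆ T) ∧ i ∈ ids S) ∧
    ∀ i S j T, view i S ∈ t → view j T ∈ t → (S ⊆ T ∨ T ⊆ S) ∧ (i ∈ ids T → S ⊆ T)}

/-- The iterated standard chromatic subdivision `Ch^r(K)`. -/
def ChIter (K : Set (Finset (Vtx n X 0))) : (r : ℕ) → Set (Finset (Vtx n X r))
  | 0 => K
  | r + 1 => Ch (ChIter K r)

/-- The simplex `σ` regarded as a complex: all its non-empty faces. -/
def facesOf {V : Type*} (σ : Finset V) : Set (Finset V) := {s | s.Nonempty ∧ s ⊆ σ}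

/-- `T` is the carrier in the complex `I` of the vertex `v` of the `r`-th subdivision of `I`: the
smallest simplex of `I` whose subdivision contains `v`. -/
def IsCarrier (I : PreAbstractSimplicialComplex (Vtx n X 0)) {r : ℕ} (v : Vtx n X r)
    (T : Finset (Vtx n X 0)) : Prop :=
  IsLeast {T | T ∈ I.faces ∧ v ∈ vertices (ChIter (facesOf T) r)} T

/-- A decision map: it assigns to each state an output value, or `none` (that is, `⊥`) if the
process has to continue. -/
abbrev DecisionMap (n : ℕ) (X Y : Type*) := (k : ℕ) → Vtx n X k → Option Y

/-- The decision in a state after `k` rounds; a terminated process keeps its decision. -/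
def decision (δ : DecisionMap n X Y) : (k : ℕ) → Vtx n X k → Option Y
  | 0, v => δ 0 v
  | k + 1, Sum.inl v => decision δ k v
  | k + 1, Sum.inr w => δ (k + 1) (Sum.inr w)

open Classical in
/-- The non-uniform chromatic subdivision `χ(K, δ)`: for each simplex `S` of `K`, the terminated
vertices of `S` are kept and joined with the standard chromatic subdivision of the face of `S`
spanned by its active vertices. -/
def chi (δ : DecisionMap n X Y) {k : ℕ} (K : Set (Finset (Vtx n X k))) :
    Set (Finset (Vtx n X (k + 1))) :=
  {t | t.Nonempty ∧ ∃ S ∈ K, ∃ T ⊆ S.filter (fun v => decision δ k v ≠ none),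
    ∃ t' : Finset (Vtx n X (k + 1)),
      (t' = ∅ ∨ t' ∈ Ch {S.filter (fun v => decision δ k v = none)}) ∧ t = T.image keep ∪ t'}

open Classical in
/-- The configuration reached from the initial configuration `σ` by a one-round schedule. The
schedule is an ordered partition of the processes, given by the index `ρ p` of the block in which
`p` takes its step: a process reads the states of the processes in its own and in earlier blocks. -/
noncomputable def oneRound (σ : Finset (Vtx n X 0)) (ρ : Fin (n + 1) → ℕ) : Finset (Vtx n X 1) :=
  σ.image fun v => view (pid v) (σ.filter fun w => ρ (pid w) ≤ ρ (pid v))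

/-- The protocol complexes `𝔽_i(U)` of a partial protocol `δ` with respect to the input simplex `U`.
`𝔽_0(U)` is the set of the input simplices that contain `U`; `𝔽_1(U)` consists of the faces of the
configurations reached from these by one-round schedules whose first block is `ids U`; and
`𝔽_{i+1}(U) = χ(𝔽_i(U), δ)` for `i ≥ 1`. -/
def protocolComplex (I : PreAbstractSimplicialComplex (Vtx n X 0)) (δ : DecisionMap n X Y)
    (U : Finset (Vtx n X 0)) : (i : ℕ) → Set (Finset (Vtx n X i))
  | 0 => {σ | σ ∈ I.faces ∧ U ⊆ σ}
  | 1 => {t | t.Nonempty ∧ ∃ σ ∈ I.faces, U ⊆ σ ∧ ∃ ρ : Fin (n + 1) → ℕ,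
      (∀ v ∈ σ, ρ (pid v) = 0 ↔ pid v ∈ ids U) ∧ t ⊆ oneRound σ ρ}
  | i + 2 => chi δ (protocolComplex I δ U (i + 1))

/-- In every execution of the partial protocol `δ` with respect to `U`, all processes terminate
exactly at the end of round `r`. -/
def TerminatesAtRound (I : PreAbstractSimplicialComplex (Vtx n X 0)) (δ : DecisionMap n X Y)
    (U : Finset (Vtx n X 0)) (r : ℕ) : Prop :=
  (∀ k < r, ∀ v ∈ vertices (protocolComplex I δ U k), decision δ k v = none) ∧
  ∀ v ∈ vertices (protocolComplex I δ U r), decision δ r v ≠ none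

/-- `s` is an `n`-simplex of `Ch^r(I)` that has an intersection (a common vertex) with `𝔽_r(U)`. -/
def Meets (I : PreAbstractSimplicialComplex (Vtx n X 0)) (δ : DecisionMap n X Y)
    (U : Finset (Vtx n X 0)) (r : ℕ) (s : Finset (Vtx n X r)) : Prop :=
  s ∈ ChIter I.faces r ∧ s.card = n + 1 ∧ ∃ v ∈ s, v ∈ vertices (protocolComplex I δ U r)

/-- The conditions on a canonical neighbour `s'` of `s` with label `U` that concern `s` alone. -/
structure IsCanonicalNeighbor (I : PreAbstractSimplicialComplex (Vtx n X 0))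
    (δ : DecisionMap n X Y) (U : Finset (Vtx n X 0)) (r : ℕ) (s s' : Finset (Vtx n X r)) :
    Prop where
  /-- `s'` is an `n`-simplex of `𝔽_r(U)`. -/
  mem : s' ∈ protocolComplex I δ U r ∧ s'.card = n + 1
  /-- `s'` contains all vertices that `s` shares with `𝔽_r(U)`. -/
  shared : ∀ v ∈ s, v ∈ vertices (protocolComplex I δ U r) → v ∈ s'
  /-- Each other vertex of `s` has the same carrier as the vertex of `s'` with the same id. -/
  carrier : ∀ v ∈ s, v ∉ vertices (protocolComplex I δ U r) →
    ∃ v' ∈ s', pid v' = pid v ∧ ∃ T, IsCarrier I v T ∧ IsCarrier I v' T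
  /-- `s'` lies in the subdivision of the same input `n`-simplex as `s`. -/
  sameInput : ∀ σ ∈ I.faces, σ.card = n + 1 → s ∈ ChIter (facesOf σ) r → s' ∈ ChIter (facesOf σ) r

end NIIS

open NIIS

/-!
The neighbour comes from a colour-preserving simplicial retraction. In a simplex `σ` of the input
complex that contains `U`, send the vertex `(i, S)` of `Ch(σ)` to `(i, U)` if `i ∈ ids U` and to
`(i, S ∪ U)` otherwise (`retractFirst`). This map is simplicial, its values span simplices of
`𝔽₁(U)` (`image_retractFirst_mem_protocolComplex`) and it fixes the vertices of `𝔽₁(U)`.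

Since nobody terminates before round `r`, the complex `𝔽_r(U)` is the `(r - 1)`-fold standard
chromatic subdivision of `𝔽₁(U)` (`protocolComplex_eq_chAbove`). Chromatic subdivision is functorial
for colour-preserving simplicial maps (`image_subdivMap_mem`), so the retraction induces a map on
the vertices of `Ch^r(σ)`, and `N(s, U)` is the image of `s` under this map. As the map is defined
on vertices and does not refer to `s`, neighbours of simplices with a common vertex share the image
of that vertex.

It remains to compare carriers. Let `A` be the carrier of a vertex `v` of `s` in the first
subdivision (`support`), and `A₀` that of a vertex of `s` in `𝔽_r(U)`. Because `r ≥ 2`, the carriers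
`A` and `A₀` are nested. If `A ⊆ A₀` then `v` is a vertex of `𝔽_r(U)`. Otherwise `A` contains some
vertex `(a, S)` of `𝔽₁(U)`, so that `U ⊆ S`; the processes of `U` then see no more than `S`, and the
retraction does not change the union of the views in `A`, which is the carrier in the input complex.
-/

open Classical

namespace NIIS

variable {n : ℕ} {X Y : Type*}

/-! ### Simplices of the chromatic subdivision -/

/-- The simplex that the process in a given state has read in its last round; by convention it is
empty if the process had terminated before. -/
def seen {k : ℕ} : Vtx n X (k + 1) → Finset (Vtx n X k)
  | Sum.inl _ => ∅
  | Sum.inr w => w.2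

@[simp] lemma seen_view {k : ℕ} (i : Fin (n + 1)) (S : Finset (Vtx n X k)) :
    seen (view i S) = S := rfl

@[simp] lemma pid_view {k : ℕ} (i : Fin (n + 1)) (S : Finset (Vtx n X k)) :
    pid (view i S) = i := rfl

lemma view_inj {k : ℕ} {i j : Fin (n + 1)} {S T : Finset (Vtx n X k)}
    (h : view i S = view j T) : i = j ∧ S = T := by
  exact Prod.mk.inj (Sum.inr.inj h)

lemma mem_ids {k : ℕ} {i : Fin (n + 1)} {S : Finset (Vtx n X k)} :
    i ∈ ids S ↔ ∃ v ∈ S, pid v = i := by simp [ids]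

lemma ids_mono {k : ℕ} {S T : Finset (Vtx n X k)} (h : S ⊆ T) : ids S ⊆ ids T :=
  Finset.image_subset_image h

lemma nonempty_of_mem_ids {k : ℕ} {i : Fin (n + 1)} {S : Finset (Vtx n X k)} (h : i ∈ ids S) :
    S.Nonempty := by
  obtain ⟨v, hv, -⟩ := mem_ids.1 h
  exact ⟨v, hv⟩

/-- A collection of simplices that is a complex: simplices are non-empty and every non-empty face
of a simplex is again a simplex. -/
def IsDownClosed {V : Type*} (K : Set (Finset V)) : Prop :=
  (∀ s ∈ K, s.Nonempty) ∧ ∀ s ∈ K, ∀ t ⊆ s, t.Nonempty → t ∈ K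

lemma isDownClosed_facesOf {V : Type*} (σ : Finset V) : IsDownClosed (facesOf σ) :=
  ⟨fun _ h => h.1, fun _ h _ ht hne => ⟨hne, ht.trans h.2⟩⟩

lemma isDownClosed_Ch {k : ℕ} (K : Set (Finset (Vtx n X k))) : IsDownClosed (Ch K) := by
  refine ⟨fun s h => h.1, fun s h t ht hne => ⟨hne, fun v hv => h.2.1 v (ht hv), ?_⟩⟩
  exact fun i S j T hS hT => h.2.2 i S j T (ht hS) (ht hT)

lemma isDownClosed_faces (I : PreAbstractSimplicialComplex (Vtx n X 0)) :
    IsDownClosed I.faces :=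
  ⟨fun _ h => (I.isRelLowerSet_faces h).1, fun _ h _ ht hne => (I.isRelLowerSet_faces h).2 ht hne⟩

/-- The views in a simplex of `Ch K` form a chain, so one of them contains all others. -/
lemma exists_largest_view {k : ℕ} {K : Set (Finset (Vtx n X k))} {t : Finset (Vtx n X (k + 1))}
    (ht : t ∈ Ch K) : ∃ i S, view i S ∈ t ∧ ∀ j T, view j T ∈ t → T ⊆ S := by
  obtain ⟨v, hv, hmax⟩ := t.exists_max_image (fun v => (seen v).card) ht.1
  obtain ⟨i, S, rfl, -, -⟩ := ht.2.1 v hv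
  refine ⟨i, S, hv, fun j T hT => ?_⟩
  rcases (ht.2.2 i S j T hv hT).1 with h | h
  · exact (Finset.eq_of_subset_of_card_le h (hmax _ hT)).ge
  · exact h

lemma injOn_pid_of_mem_Ch {k : ℕ} {K : Set (Finset (Vtx n X k))} {t : Finset (Vtx n X (k + 1))}
    (ht : t ∈ Ch K) : Set.InjOn pid (t : Set (Vtx n X (k + 1))) := by
  intro v hv w hw h
  obtain ⟨i, S, rfl, -, hi⟩ := ht.2.1 v hv
  obtain ⟨j, T, rfl, -, hj⟩ := ht.2.1 w hw
  obtain rfl : i = j := h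
  rw [((ht.2.2 i S i T hv hw).2 hj).antisymm ((ht.2.2 i T i S hw hv).2 hi)]

/-- The union of the views in a simplex of `Ch K` is the largest one, hence a simplex of `K`. -/
lemma biUnion_seen_mem {k : ℕ} {K : Set (Finset (Vtx n X k))} (hK : IsDownClosed K)
    {t : Finset (Vtx n X (k + 1))} (ht : t ∈ Ch K) : t.biUnion seen ∈ K := by
  obtain ⟨i, S, hS, hmax⟩ := exists_largest_view ht
  obtain ⟨i', S', he, ⟨T, hT, hST⟩, hi⟩ := ht.2.1 _ hS
  obtain ⟨rfl, rfl⟩ := view_inj he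
  have : t.biUnion seen = S := by
    refine Finset.Subset.antisymm (Finset.biUnion_subset.2 fun v hv => ?_)
      (Finset.subset_biUnion_of_mem seen hS)
    obtain ⟨j, R, rfl, -, -⟩ := ht.2.1 v hv
    exact hmax j R hv
  rw [this]
  exact hK.2 T hT S hST (nonempty_of_mem_ids hi)

lemma mem_Ch_facesOf_iff {k : ℕ} {K : Set (Finset (Vtx n X k))} {t : Finset (Vtx n X (k + 1))}
    (ht : t ∈ Ch K) {T : Finset (Vtx n X k)} : t ∈ Ch (facesOf T) ↔ t.biUnion seen ⊆ T := by
  constructor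
  · intro h
    exact (biUnion_seen_mem (isDownClosed_facesOf T) h).2
  · intro h
    refine ⟨ht.1, fun v hv => ?_, ht.2.2⟩
    obtain ⟨i, S, rfl, -, hi⟩ := ht.2.1 v hv
    have hST : S ⊆ T := (Finset.subset_biUnion_of_mem seen hv).trans h
    exact ⟨i, S, rfl, ⟨S, ⟨nonempty_of_mem_ids hi, hST⟩, subset_rfl⟩, hi⟩

/-! ### Iterated subdivision of a complex on the first level -/

/-- The `k`-fold standard chromatic subdivision of a collection `L` of simplices whose vertices are
states after one round. -/
def chAbove (L : Set (Finset (Vtx n X 1))) : (k : ℕ) → Set (Finset (Vtx n X (k + 1)))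
  | 0 => L
  | k + 1 => Ch (chAbove L k)

lemma chIter_succ (K : Set (Finset (Vtx n X 0))) (k : ℕ) :
    ChIter K (k + 1) = chAbove (Ch K) k := by
  induction k with
  | zero => rfl
  | succ k ih => exact congrArg Ch ih

lemma isDownClosed_chAbove {L : Set (Finset (Vtx n X 1))} (hL : IsDownClosed L) :
    (k : ℕ) → IsDownClosed (chAbove L k)
  | 0 => hL
  | _ + 1 => isDownClosed_Ch _

/-- The carrier of a vertex of an iterated subdivision in the complex on the first level that is
subdivided: the set of all states after one round that the state depends on. -/
noncomputable def support : (k : ℕ) → Vtx n X (k + 1) → Finset (Vtx n X 1)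
  | 0, v => {v}
  | k + 1, Sum.inl v => support k v
  | k + 1, Sum.inr w => w.2.biUnion (support k)

lemma support_view {k : ℕ} (i : Fin (n + 1)) (S : Finset (Vtx n X (k + 1))) :
    support (k + 1) (view i S) = S.biUnion (support k) := rfl

lemma biUnion_support_mem {L : Set (Finset (Vtx n X 1))} (hL : IsDownClosed L) {k : ℕ}
    {s : Finset (Vtx n X (k + 1))} (hs : s ∈ chAbove L k) : s.biUnion (support k) ∈ L := by
  induction k with
  | zero =>
    have : s.biUnion (support 0) = s := Finset.biUnion_singleton_eq_self
    rwa [this]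
  | succ k ih =>
    have h := ih (biUnion_seen_mem (isDownClosed_chAbove hL k) hs)
    rw [Finset.biUnion_biUnion] at h
    convert h using 1
    refine Finset.biUnion_congr rfl fun v hv => ?_
    obtain ⟨i, S, rfl, -, -⟩ := hs.2.1 v hv
    rfl

lemma mem_chAbove_of_biUnion_support_mem {L L' : Set (Finset (Vtx n X 1))} (hL : IsDownClosed L)
    (hL' : IsDownClosed L') {k : ℕ} {s : Finset (Vtx n X (k + 1))} (hs : s ∈ chAbove L k)
    (h : s.biUnion (support k) ∈ L') : s ∈ chAbove L' k := by
  induction k with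
  | zero =>
    have : s.biUnion (support 0) = s := Finset.biUnion_singleton_eq_self
    rwa [this] at h
  | succ k ih =>
    refine ⟨hs.1, fun v hv => ?_, hs.2.2⟩
    obtain ⟨i, S, rfl, ⟨T, hT, hST⟩, hi⟩ := hs.2.1 v hv
    have hS := (isDownClosed_chAbove hL k).2 T hT S hST (nonempty_of_mem_ids hi)
    refine ⟨i, S, rfl, ⟨S, ih hS ?_, subset_rfl⟩, hi⟩
    exact hL'.2 _ h _ (Finset.subset_biUnion_of_mem (support (k + 1)) hv)
      (hL.1 _ (biUnion_support_mem hL hS))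

lemma mem_vertices_of_mem_support {L : Set (Finset (Vtx n X 1))} {k : ℕ} {v : Vtx n X (k + 1)}
    (hv : v ∈ vertices (chAbove L k)) {w : Vtx n X 1} (hw : w ∈ support k v) :
    w ∈ vertices L := by
  induction k with
  | zero =>
    obtain rfl : w = v := by simpa [support] using hw
    exact hv
  | succ k ih =>
    obtain ⟨t, ht, hvt⟩ := hv
    obtain ⟨i, S, rfl, ⟨T, hT, hST⟩, hi⟩ := ht.2.1 v hvt
    rw [support_view, Finset.mem_biUnion] at hw
    obtain ⟨u, hu, hw⟩ := hw
    exact ih ⟨T, hT, hST hu⟩ hw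

/-- From the second level on, the carriers of the vertices of a simplex are nested. -/
lemma support_subset_or_subset {L : Set (Finset (Vtx n X 1))} {k : ℕ}
    {s : Finset (Vtx n X (k + 2))} (hs : s ∈ chAbove L (k + 1)) {v w : Vtx n X (k + 2)}
    (hv : v ∈ s) (hw : w ∈ s) :
    support (k + 1) v ⊆ support (k + 1) w ∨ support (k + 1) w ⊆ support (k + 1) v := by
  obtain ⟨i, S, rfl, -, -⟩ := hs.2.1 v hv
  obtain ⟨j, T, rfl, -, -⟩ := hs.2.1 w hw
  exact (hs.2.2 i S j T hv hw).1.imp (Finset.biUnion_subset_biUnion_of_subset_left _)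
    (Finset.biUnion_subset_biUnion_of_subset_left _)

lemma support_mem {L : Set (Finset (Vtx n X 1))} (hL : IsDownClosed L) {k : ℕ}
    {v : Vtx n X (k + 1)} (hv : v ∈ vertices (chAbove L k)) : support k v ∈ L := by
  obtain ⟨t, ht, hvt⟩ := hv
  have := (isDownClosed_chAbove hL k).2 t ht {v} (by simpa using hvt) (by simp)
  simpa using biUnion_support_mem hL this

/-- The carrier in the input complex is the union of the views in the carrier in the first
subdivision. -/
lemma isCarrier_biUnion_seen (I : PreAbstractSimplicialComplex (Vtx n X 0)) {k : ℕ}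
    {v : Vtx n X (k + 1)} (hv : v ∈ vertices (chAbove (Ch I.faces) k)) :
    IsCarrier I v ((support k v).biUnion seen) := by
  have hA := support_mem (isDownClosed_Ch _) hv
  refine ⟨⟨biUnion_seen_mem (isDownClosed_faces I) hA, ?_⟩, ?_⟩
  · obtain ⟨t, ht, hvt⟩ := hv
    have h1 := (isDownClosed_chAbove (isDownClosed_Ch _) k).2 t ht {v}
      (by simpa using hvt) (by simp)
    refine ⟨{v}, ?_, by simp⟩
    rw [chIter_succ]
    refine mem_chAbove_of_biUnion_support_mem (isDownClosed_Ch _) (isDownClosed_Ch _) h1 ?_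
    rw [Finset.singleton_biUnion]
    exact (mem_Ch_facesOf_iff hA).2 subset_rfl
  · rintro T ⟨-, hT⟩
    rw [chIter_succ] at hT
    exact (mem_Ch_facesOf_iff hA).1 (support_mem (isDownClosed_Ch _) hT)

/-! ### Functoriality of the subdivision -/

/-- The map that a map of states after one round induces on the states after later rounds: it is
applied to all states after one round that a process has read, directly or indirectly. -/
noncomputable def subdivMap (φ : Vtx n X 1 → Vtx n X 1) :
    (k : ℕ) → Vtx n X (k + 1) → Vtx n X (k + 1)
  | 0, v => φ v
  | k + 1, Sum.inl v => keep (subdivMap φ k v)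
  | k + 1, Sum.inr w => view w.1 (w.2.image (subdivMap φ k))

section subdivMap

variable {φ : Vtx n X 1 → Vtx n X 1}

lemma subdivMap_view {k : ℕ} (i : Fin (n + 1)) (S : Finset (Vtx n X (k + 1))) :
    subdivMap φ (k + 1) (view i S) = view i (S.image (subdivMap φ k)) := rfl

lemma pid_subdivMap (hφ : ∀ v, pid (φ v) = pid v) : {k : ℕ} → (v : Vtx n X (k + 1)) →
    pid (subdivMap φ k v) = pid v
  | 0, v => hφ v
  | _ + 1, Sum.inl v => pid_subdivMap hφ v
  | _ + 1, Sum.inr _ => rfl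

lemma ids_image_subdivMap (hφ : ∀ v, pid (φ v) = pid v) {k : ℕ}
    (S : Finset (Vtx n X (k + 1))) : ids (S.image (subdivMap φ k)) = ids S := by
  ext i
  simp [mem_ids, pid_subdivMap hφ]

lemma image_subdivMap_mem (hφ : ∀ v, pid (φ v) = pid v) {L L' : Set (Finset (Vtx n X 1))}
    (h : ∀ t ∈ L, t.image φ ∈ L') {k : ℕ} {s : Finset (Vtx n X (k + 1))}
    (hs : s ∈ chAbove L k) : s.image (subdivMap φ k) ∈ chAbove L' k := by
  induction k with
  | zero => exact h s hs
  | succ k ih =>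
    have key : ∀ v ∈ s.image (subdivMap φ (k + 1)), ∃ i S, view i S ∈ s ∧
        v = view i (S.image (subdivMap φ k)) := by
      intro v hv
      obtain ⟨w, hw, rfl⟩ := Finset.mem_image.1 hv
      obtain ⟨i, S, rfl, -, -⟩ := hs.2.1 w hw
      exact ⟨i, S, hw, subdivMap_view i S⟩
    refine ⟨hs.1.image _, fun v hv => ?_, fun i S j T hS hT => ?_⟩
    · obtain ⟨i, S, hS, rfl⟩ := key v hv
      obtain ⟨i', S', he, ⟨T, hT, hST⟩, hi⟩ := hs.2.1 _ hS
      obtain ⟨rfl, rfl⟩ := view_inj he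
      exact ⟨i, _, rfl, ⟨_, ih hT, Finset.image_subset_image hST⟩,
        by rwa [ids_image_subdivMap hφ]⟩
    · obtain ⟨i', S', hS', he⟩ := key _ hS
      obtain ⟨rfl, rfl⟩ := view_inj he
      obtain ⟨j', T', hT', he⟩ := key _ hT
      obtain ⟨rfl, rfl⟩ := view_inj he
      rw [ids_image_subdivMap hφ]
      have := hs.2.2 _ _ _ _ hS' hT'
      exact ⟨this.1.imp Finset.image_subset_image Finset.image_subset_image,
        fun hi => Finset.image_subset_image (this.2 hi)⟩

lemma subdivMap_eq_self {k : ℕ} {L : Set (Finset (Vtx n X 1))} {v : Vtx n X (k + 1)}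
    (hv : v ∈ vertices (chAbove L k)) (h : ∀ w ∈ support k v, φ w = w) :
    subdivMap φ k v = v := by
  induction k with
  | zero => exact h v (by simp [support])
  | succ k ih =>
    obtain ⟨t, ht, hvt⟩ := hv
    obtain ⟨i, S, rfl, ⟨T, hT, hST⟩, -⟩ := ht.2.1 v hvt
    have hS : ∀ u ∈ S, subdivMap φ k u = u := fun u hu =>
      ih ⟨T, hT, hST hu⟩ fun w hw => h w (Finset.mem_biUnion.2 ⟨u, hu, hw⟩)
    rw [subdivMap_view, Finset.image_congr (g := id) hS, Finset.image_id]

lemma support_subdivMap {k : ℕ} {L : Set (Finset (Vtx n X 1))} {v : Vtx n X (k + 1)}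
    (hv : v ∈ vertices (chAbove L k)) :
    support k (subdivMap φ k v) = (support k v).image φ := by
  induction k with
  | zero => simp [support, subdivMap]
  | succ k ih =>
    obtain ⟨t, ht, hvt⟩ := hv
    obtain ⟨i, S, rfl, ⟨T, hT, hST⟩, -⟩ := ht.2.1 v hvt
    rw [subdivMap_view, support_view, support_view, Finset.image_biUnion, Finset.biUnion_image]
    exact Finset.biUnion_congr rfl fun u hu => ih ⟨T, hT, hST hu⟩

end subdivMap

/-! ### The protocol complexes -/

/-- If no vertex has terminated, the non-uniform subdivision is the standard one. -/
lemma chi_eq_Ch {δ : DecisionMap n X Y} {k : ℕ} {K : Set (Finset (Vtx n X k))}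
    (h : ∀ v ∈ vertices K, decision δ k v = none) : chi δ K = Ch K := by
  have hS : ∀ S ∈ K, S.filter (fun v => decision δ k v = none) = S := fun S hS =>
    Finset.filter_true_of_mem fun v hv => h v ⟨S, hS, hv⟩
  ext t
  constructor
  · rintro ⟨hne, S, hSK, T, hT, t', ht', rfl⟩
    obtain rfl : T = ∅ := Finset.subset_empty.1 fun v hv => by
      have := Finset.mem_filter.1 (hT hv)
      exact (this.2 (h v ⟨S, hSK, this.1⟩)).elim
    simp only [Finset.image_empty, Finset.empty_union] at hne ⊢
    rcases ht' with rfl | ht'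
    · simp at hne
    · rw [hS S hSK] at ht'
      refine ⟨hne, fun v hv => ?_, ht'.2.2⟩
      obtain ⟨i, R, rfl, ⟨T, rfl, hR⟩, hi⟩ := ht'.2.1 v hv
      exact ⟨i, R, rfl, ⟨T, hSK, hR⟩, hi⟩
  · intro ht
    obtain ⟨i, S, hS', hmax⟩ := exists_largest_view ht
    obtain ⟨i', S', he, ⟨T, hT, hST⟩, -⟩ := ht.2.1 _ hS'
    obtain ⟨rfl, rfl⟩ := view_inj he
    refine ⟨ht.1, T, hT, ∅, by simp, t, Or.inr ?_, by simp⟩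
    rw [hS T hT]
    refine ⟨ht.1, fun v hv => ?_, ht.2.2⟩
    obtain ⟨j, R, rfl, -, hj⟩ := ht.2.1 v hv
    exact ⟨j, R, rfl, ⟨T, rfl, (hmax j R hv).trans hST⟩, hj⟩

lemma protocolComplex_eq_chAbove {I : PreAbstractSimplicialComplex (Vtx n X 0)}
    {δ : DecisionMap n X Y} {U : Finset (Vtx n X 0)} {r : ℕ} (hδ : TerminatesAtRound I δ U r)
    {k : ℕ} (hk : k < r) :
    protocolComplex I δ U (k + 1) = chAbove (protocolComplex I δ U 1) k := by
  induction k with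
  | zero => rfl
  | succ k ih =>
    have : protocolComplex I δ U (k + 2) = chi δ (protocolComplex I δ U (k + 1)) := rfl
    rw [this, chi_eq_Ch (hδ.1 (k + 1) hk), ih (by omega)]
    rfl

lemma eq_of_mem_of_pid_mem_ids {I : PreAbstractSimplicialComplex (Vtx n X 0)}
    (hI : IsChromatic I) {σ S : Finset (Vtx n X 0)} (hσ : σ ∈ I.faces) (hS : S ⊆ σ)
    {w : Vtx n X 0} (hw : w ∈ σ) (h : pid w ∈ ids S) : w ∈ S := by
  obtain ⟨u, hu, he⟩ := mem_ids.1 h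
  rwa [← hI σ hσ (hS hu) hw he]

/-- The vertices of `𝔽₁(U)` see all of `U`, and the processes of `U` see nothing else. -/
lemma exists_eq_view_of_mem_protocolComplex {I : PreAbstractSimplicialComplex (Vtx n X 0)}
    (hI : IsChromatic I) {δ : DecisionMap n X Y} {U : Finset (Vtx n X 0)} {v : Vtx n X 1}
    (hv : v ∈ vertices (protocolComplex I δ U 1)) :
    ∃ i S, v = view i S ∧ U ⊆ S ∧ (i ∈ ids U → S = U) := by
  obtain ⟨t, ⟨-, σ, hσ, hU, ρ, hρ, ht⟩, hvt⟩ := hv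
  obtain ⟨w, hw, rfl⟩ := Finset.mem_image.1 (ht hvt)
  have hsub : U ⊆ σ.filter fun u => ρ (pid u) ≤ ρ (pid w) := fun u hu => by
    have := (hρ u (hU hu)).2 (mem_ids.2 ⟨u, hu, rfl⟩)
    simp [hU hu, this]
  refine ⟨_, _, rfl, hsub, fun hi => hsub.antisymm' fun u hu => ?_⟩
  have hu := Finset.mem_filter.1 hu
  rw [(hρ w hw).2 hi, Nat.le_zero] at hu
  exact eq_of_mem_of_pid_mem_ids hI hσ hU hu.1 ((hρ u hu.1).1 hu.2)

/-- A simplex of `Ch(σ)` in which everybody sees `U` and the processes of `U` see nothing else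
belongs to `𝔽₁(U)`. -/
lemma mem_protocolComplex_one {I : PreAbstractSimplicialComplex (Vtx n X 0)}
    (hI : IsChromatic I) (δ : DecisionMap n X Y) {U σ : Finset (Vtx n X 0)} (hσ : σ ∈ I.faces)
    (hU : U ⊆ σ) {t : Finset (Vtx n X 1)} (ht : t ∈ Ch (facesOf σ))
    (h : ∀ i S, view i S ∈ t → U ⊆ S ∧ (i ∈ ids U → S = U)) :
    t ∈ protocolComplex I δ U 1 := by
  -- The block of a process is the number of views, `U` included, in which it does not occur.
  set V := insert U (t.image seen) with hV
  have hVU : ∀ S ∈ V, U ⊆ S := by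
    intro S hS
    rcases Finset.mem_insert.1 hS with rfl | hS
    · exact subset_rfl
    · obtain ⟨v, hv, rfl⟩ := Finset.mem_image.1 hS
      obtain ⟨i, S, rfl, -, -⟩ := ht.2.1 v hv
      exact (h i S hv).1
  refine ⟨ht.1, σ, hσ, hU, fun p => (V.filter fun S => p ∉ ids S).card, ?_, ?_⟩
  · intro v _
    rw [Finset.card_eq_zero, Finset.filter_eq_empty_iff]
    refine ⟨fun hv => not_not.1 (hv (Finset.mem_insert_self _ _)), fun hv S hS => ?_⟩
    exact not_not.2 (ids_mono (hVU S hS) hv)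
  · intro v hv
    obtain ⟨i, S, rfl, ⟨T, hT, hST⟩, hi⟩ := ht.2.1 v hv
    have hSσ : S ⊆ σ := hST.trans hT.2
    have hSV : S ∈ V := Finset.mem_insert_of_mem (Finset.mem_image.2 ⟨_, hv, rfl⟩)
    have hchain : ∀ R ∈ V, (R ⊆ S ∨ S ⊆ R) ∧ (i ∈ ids R → S ⊆ R) := by
      intro R hR
      rcases Finset.mem_insert.1 hR with rfl | hR
      · exact ⟨Or.inl (h i S hv).1, fun hi => ((h i S hv).2 hi).le⟩
      · obtain ⟨w, hw, rfl⟩ := Finset.mem_image.1 hR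
        obtain ⟨j, R, rfl, -, -⟩ := ht.2.1 w hw
        exact ⟨(ht.2.2 i S j R hv hw).1.symm, (ht.2.2 i S j R hv hw).2⟩
    obtain ⟨u, hu, rfl⟩ := mem_ids.1 hi
    refine Finset.mem_image.2 ⟨u, hSσ hu, ?_⟩
    congr 1
    ext w
    rw [Finset.mem_filter]
    constructor
    · rintro ⟨hw, hle⟩
      by_contra hwS
      have hwS' : pid w ∉ ids S := fun hc => hwS (eq_of_mem_of_pid_mem_ids hI hσ hSσ hw hc)
      refine absurd hle (not_le.2 (Finset.card_lt_card
        (Finset.ssubset_iff_subset_ne.2 ⟨fun R hR => ?_, fun he => ?_⟩)))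
      · rw [Finset.mem_filter] at hR ⊢
        refine ⟨hR.1, fun hc => ?_⟩
        rcases (hchain R hR.1).1 with hRS | hSR
        · exact hwS' (ids_mono hRS hc)
        · exact hR.2 (ids_mono hSR hi)
      · have : S ∈ V.filter fun S => pid w ∉ ids S := Finset.mem_filter.2 ⟨hSV, hwS'⟩
        rw [← he, Finset.mem_filter] at this
        exact this.2 hi
    · intro hw
      refine ⟨hSσ hw, Finset.card_le_card fun R hR => ?_⟩
      rw [Finset.mem_filter] at hR ⊢
      exact ⟨hR.1, fun hc => hR.2 (ids_mono ((hchain R hR.1).2 hc) (mem_ids.2 ⟨w, hw, rfl⟩))⟩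

/-! ### The retraction onto the first protocol complex -/

/-- The retraction of the first subdivision onto `𝔽₁(U)`: the processes of `U` see exactly `U`, the
others see `U` in addition to what they have seen. -/
noncomputable def retractFirst (U : Finset (Vtx n X 0)) (v : Vtx n X 1) : Vtx n X 1 :=
  view (pid v) (if pid v ∈ ids U then U else seen v ∪ U)

lemma pid_retractFirst (U : Finset (Vtx n X 0)) (v : Vtx n X 1) :
    pid (retractFirst U v) = pid v := rfl

lemma seen_retractFirst (U : Finset (Vtx n X 0)) (v : Vtx n X 1) :
    seen (retractFirst U v) = if pid v ∈ ids U then U else seen v ∪ U := rfl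

lemma retractFirst_eq_self {U S : Finset (Vtx n X 0)} {i : Fin (n + 1)} (hU : U ⊆ S)
    (h : i ∈ ids U → S = U) : retractFirst U (view i S) = view i S := by
  unfold retractFirst
  by_cases hi : i ∈ ids U
  · simp [hi, h hi]
  · simp [hi, Finset.union_eq_left.2 hU]

lemma image_retractFirst_mem_Ch {U σ : Finset (Vtx n X 0)} (hU : U ⊆ σ) {t : Finset (Vtx n X 1)}
    (ht : t ∈ Ch (facesOf σ)) : t.image (retractFirst U) ∈ Ch (facesOf σ) := by
  refine ⟨ht.1.image _, fun v hv => ?_, fun i S j T hS hT => ?_⟩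
  · obtain ⟨w, hw, rfl⟩ := Finset.mem_image.1 hv
    obtain ⟨i, S, rfl, ⟨T, hT, hST⟩, hi⟩ := ht.2.1 w hw
    have hσ : σ ∈ facesOf σ := ⟨hT.1.mono hT.2, subset_rfl⟩
    refine ⟨i, _, rfl, ⟨σ, hσ, ?_⟩, ?_⟩ <;> rw [pid_view, seen_view] <;> split_ifs with h
    · exact hU
    · exact Finset.union_subset (hST.trans hT.2) hU
    · exact h
    · exact ids_mono Finset.subset_union_left hi
  · obtain ⟨w, hw, he⟩ := Finset.mem_image.1 hS
    obtain ⟨i, S, rfl, -, hi⟩ := ht.2.1 w hw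
    obtain ⟨rfl, rfl⟩ := view_inj he
    obtain ⟨w, hw', he⟩ := Finset.mem_image.1 hT
    obtain ⟨j, T, rfl, -, hj⟩ := ht.2.1 w hw'
    obtain ⟨rfl, rfl⟩ := view_inj he
    have hc := ht.2.2 i S j T hw hw'
    by_cases h₁ : pid (view i S) ∈ ids U <;> by_cases h₂ : pid (view j T) ∈ ids U
    · rw [if_pos h₁, if_pos h₂]
      exact ⟨Or.inl subset_rfl, fun _ => subset_rfl⟩
    · rw [if_pos h₁, if_neg h₂]
      exact ⟨Or.inl Finset.subset_union_right, fun _ => Finset.subset_union_right⟩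
    · rw [if_neg h₁, if_pos h₂]
      exact ⟨Or.inr Finset.subset_union_right, fun h => (h₁ h).elim⟩
    · rw [if_neg h₁, if_neg h₂]
      refine ⟨hc.1.imp (Finset.union_subset_union_left ·) (Finset.union_subset_union_left ·),
        fun h => Finset.union_subset_union_left (hc.2 ?_)⟩
      obtain ⟨u, hu, he⟩ := mem_ids.1 h
      rcases Finset.mem_union.1 hu with hu | hu
      · exact mem_ids.2 ⟨u, hu, he⟩
      · exact (h₁ (mem_ids.2 ⟨u, hu, he⟩)).elim

lemma image_retractFirst_mem_protocolComplex {I : PreAbstractSimplicialComplex (Vtx n X 0)}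
    (hI : IsChromatic I) (δ : DecisionMap n X Y) {U σ : Finset (Vtx n X 0)} (hσ : σ ∈ I.faces)
    (hU : U ⊆ σ) {t : Finset (Vtx n X 1)} (ht : t ∈ Ch (facesOf σ)) :
    t.image (retractFirst U) ∈ protocolComplex I δ U 1 := by
  refine mem_protocolComplex_one hI δ hσ hU (image_retractFirst_mem_Ch hU ht) fun i S hS => ?_
  obtain ⟨w, hw, he⟩ := Finset.mem_image.1 hS
  obtain ⟨rfl, rfl⟩ := view_inj he
  split_ifs with h
  · exact ⟨subset_rfl, fun _ => rfl⟩
  · exact ⟨Finset.subset_union_right, fun hi => (h hi).elim⟩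

/-- The retraction keeps the union of the views of a simplex that contains a vertex of `𝔽₁(U)`. -/
lemma biUnion_seen_image_retractFirst {K : Set (Finset (Vtx n X 0))} {U S : Finset (Vtx n X 0)}
    {t : Finset (Vtx n X 1)} (ht : t ∈ Ch K) {a : Fin (n + 1)} (ha : view a S ∈ t) (hU : U ⊆ S)
    (haU : a ∈ ids U → S = U) :
    (t.image (retractFirst U)).biUnion seen = t.biUnion seen := by
  have hSt : S ⊆ t.biUnion seen := Finset.subset_biUnion_of_mem seen ha
  have hSt' : S ⊆ (t.image (retractFirst U)).biUnion seen :=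
    Finset.subset_biUnion_of_mem seen
      (Finset.mem_image.2 ⟨_, ha, retractFirst_eq_self hU haU⟩)
  refine Finset.Subset.antisymm (Finset.biUnion_subset.2 fun v hv => ?_)
    (Finset.biUnion_subset.2 fun v hv => ?_)
  · obtain ⟨w, hw, rfl⟩ := Finset.mem_image.1 hv
    rw [seen_retractFirst]
    split_ifs
    · exact hU.trans hSt
    · exact Finset.union_subset (Finset.subset_biUnion_of_mem seen hw) (hU.trans hSt)
  · obtain ⟨i, T, rfl, -, -⟩ := ht.2.1 v hv
    by_cases hi : i ∈ ids U
    · -- A process of `U` occurs in the view `S`, hence sees no more than `S`.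
      exact ((ht.2.2 i T a S hv ha).2 (ids_mono hU hi)).trans hSt'
    · refine Finset.Subset.trans ?_
        (Finset.subset_biUnion_of_mem seen (Finset.mem_image_of_mem _ hv))
      rw [seen_retractFirst, pid_view, if_neg hi]
      exact Finset.subset_union_left

/-! ### The canonical neighbour -/

/-- The image of a simplex under the map induced by the retraction is a canonical neighbour. -/
lemma isCanonicalNeighbor_image {I : PreAbstractSimplicialComplex (Vtx n X 0)}
    (hI : IsChromatic I) {k : ℕ} {U : Finset (Vtx n X 0)} {δ : DecisionMap n X Y}
    (hδ : TerminatesAtRound I δ U (k + 2)) {s : Finset (Vtx n X (k + 2))}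
    (hs : Meets I δ U (k + 2) s) :
    IsCanonicalNeighbor I δ U (k + 2) s (s.image (subdivMap (retractFirst U) (k + 1))) := by
  have hP := protocolComplex_eq_chAbove hδ (show k + 1 < k + 2 by omega)
  obtain ⟨hsI, hcard, v₀, hv₀s, hv₀⟩ := hs
  rw [hP] at hv₀
  rw [chIter_succ] at hsI
  have hsL : ∀ {v}, v ∈ s → v ∈ vertices (chAbove (Ch I.faces) (k + 1)) := fun hv => ⟨s, hsI, hv⟩
  obtain ⟨w₀, hw₀⟩ := (isDownClosed_Ch I.faces).1 _ (support_mem (isDownClosed_Ch _) (hsL hv₀s))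
  obtain ⟨a, S, rfl, hUS, haU⟩ :=
    exists_eq_view_of_mem_protocolComplex hI (mem_vertices_of_mem_support hv₀ hw₀)
  have hfix : ∀ v ∈ vertices (chAbove (protocolComplex I δ U 1) (k + 1)),
      ∀ w ∈ support (k + 1) v, retractFirst U w = w := by
    intro v hv w hw
    obtain ⟨i, S, rfl, h, h'⟩ :=
      exists_eq_view_of_mem_protocolComplex hI (mem_vertices_of_mem_support hv hw)
    exact retractFirst_eq_self h h'
  -- The views in the support of `s` span an input simplex that contains `U`.
  have hsupp := biUnion_support_mem (isDownClosed_Ch I.faces) hsI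
  have hw₀s := Finset.mem_biUnion.2 ⟨v₀, hv₀s, hw₀⟩
  set A := s.biUnion (support (k + 1)) with hA
  have hUA : U ⊆ A.biUnion seen := hUS.trans (Finset.subset_biUnion_of_mem seen hw₀s)
  have hAI := biUnion_seen_mem (isDownClosed_faces I) hsupp
  have hsσ : s ∈ chAbove (Ch (facesOf (A.biUnion seen))) (k + 1) :=
    mem_chAbove_of_biUnion_support_mem (isDownClosed_Ch _) (isDownClosed_Ch _) hsI
      ((mem_Ch_facesOf_iff hsupp).2 subset_rfl)
  have himg : s.image (subdivMap (retractFirst U) (k + 1)) ∈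
      chAbove (protocolComplex I δ U 1) (k + 1) :=
    image_subdivMap_mem (pid_retractFirst U)
      (fun t ht => image_retractFirst_mem_protocolComplex hI δ hAI hUA ht) hsσ
  have hpid := fun v : Vtx n X (k + 2) => pid_subdivMap (pid_retractFirst U) v
  refine ⟨⟨hP ▸ himg, ?_⟩, fun v hv hvP => ?_, fun v hv hvP => ?_, fun σ hσ _ hs' => ?_⟩
  · rw [Finset.card_image_of_injOn, hcard]
    intro v hv w hw h
    exact injOn_pid_of_mem_Ch hsI hv hw (by rw [← hpid v, ← hpid w, h])
  · rw [hP] at hvP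
    exact Finset.mem_image.2 ⟨v, hv, subdivMap_eq_self hvP (hfix v hvP)⟩
  · refine ⟨_, Finset.mem_image_of_mem _ hv, hpid v, _, isCarrier_biUnion_seen I (hsL hv), ?_⟩
    have hsub : support (k + 1) v₀ ⊆ support (k + 1) v := by
      refine (support_subset_or_subset hsI hv hv₀s).resolve_left fun hle => hvP ?_
      rw [hP]
      refine ⟨_, himg, Finset.mem_image.2 ⟨v, hv, subdivMap_eq_self (hsL hv) fun w hw => ?_⟩⟩
      exact hfix v₀ hv₀ w (hle hw)
    have hv' : subdivMap (retractFirst U) (k + 1) v ∈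
        vertices (chAbove (Ch I.faces) (k + 1)) := by
      refine ⟨_, image_subdivMap_mem (L' := Ch I.faces) (pid_retractFirst U) (fun t ht => ?_) hsσ,
        Finset.mem_image_of_mem _ hv⟩
      have ht' := image_retractFirst_mem_Ch hUA ht
      refine ⟨ht'.1, fun w hw => ?_, ht'.2.2⟩
      obtain ⟨i, S, hw, ⟨T, hT, hST⟩, hi⟩ := ht'.2.1 w hw
      exact ⟨i, S, hw, ⟨_, hAI, hST.trans hT.2⟩, hi⟩
    have hc := isCarrier_biUnion_seen I hv'
    rwa [support_subdivMap (hsL hv), biUnion_seen_image_retractFirst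
      (support_mem (isDownClosed_Ch _) (hsL hv)) (hsub hw₀) hUS haU] at hc
  · rw [chIter_succ] at hs' ⊢
    refine image_subdivMap_mem (pid_retractFirst U)
      (fun t ht => image_retractFirst_mem_Ch (hUA.trans ?_) ht) hs'
    exact (mem_Ch_facesOf_iff hsupp).1 (biUnion_support_mem (isDownClosed_Ch _) hs')

end NIIS


theorem mainTheorem7 {n : ℕ} {X Y : Type*} (I : PreAbstractSimplicialComplex (Vtx n X 0))
    (hI : IsChromatic I) (r : ℕ) (hr : 2 ≤ r) (U : Finset (Vtx n X 0)) (hU : U ∈ I.faces)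
    (δ : DecisionMap n X Y) (hδ : TerminatesAtRound I δ U r) :
    ∃ N : Finset (Vtx n X r) → Finset (Vtx n X r),
      (∀ s, Meets I δ U r s → IsCanonicalNeighbor I δ U r s (N s)) ∧
      ∀ s₁ s₂, Meets I δ U r s₁ → Meets I δ U r s₂ →
        ∀ v, v ∈ s₁ → v ∈ s₂ → ∃ v', v' ∈ N s₁ ∧ v' ∈ N s₂ ∧ pid v' = pid v := by
  obtain ⟨k, rfl⟩ := Nat.exists_eq_add_of_le' hr
  refine ⟨fun s => s.image (subdivMap (retractFirst U) (k + 1)),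
    fun s hs => isCanonicalNeighbor_image hI hδ hs, fun s₁ s₂ _ _ v h₁ h₂ => ?_⟩
  exact ⟨_, Finset.mem_image_of_mem _ h₁, Finset.mem_image_of_mem _ h₂,
    pid_subdivMap (pid_retractFirst U) v⟩
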